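/- **Setting.** A (simplicial) complex $K$ is a family of nonempty finite sets, closed under passing to nonempty subsets; $V=\bigcup K$ is its vertex set. Its geometric realization $|K|$ is the set of vectors $\alpha\in[0,1]^V$ with $\sum_{v}\alpha_v=1$ whose carrier $\{v:\alpha_v>0\}$ belongs to $K$, with the Euclidean metric $d(\alpha,\beta)=\bigl(\sum_{v}(\alpha_v-\beta_v)^2\bigr)^{1/2}$. A simplicial map $\phi:K\to L$ is a map of vertices sending simplices to simplices; its realization $|\phi|:|K|\to|L|$ is $\sum\alpha_v v^\star\mapsto\sum\alpha_v\,\phi(v)^\star$, where $v^\star$ is the point of the realization corresponding to the vertex $v$. The barycentric subdivision $K'$ has the barycenters $b(s)=\frac1{|s|}\sum_{v\in s}v^\star$ ($s\in K$) as vertices and the sets $\{b(s_0),\dots,b(s_k)\}$ with $s_0\subset\dots\subset s_k$ in $K$ as simplices; $|\iota|:|K'|\to|K|$ is the homeomorphism $\sum_j\alpha_j\,b(s_j)^\star\mapsto\sum_j\alpha_j\,b(s_j)$. Iterating, one obtains $K^{(m)}$ and a homeomorphism $|\iota|^m:|K^{(m)}|\to|K|$. Fix a total order on the vertices of $K$.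 For $n\ge0$ the complex $K^n$ has as simplices the nonempty finite sets of $n$-tuples of vertices of $K$ that are chains in the coordinatewise order and all of whose $n$ coordinate projections are simplices of $K$ ($K^0$ is a one-point complex). The realizations of the coordinate projections give a homeomorphism $|\pi|^n:|K^n|\to|K|^n$. An operation $G:|K|^n\to|K|$ is *simplicial* if there are positive integers $M,N$ and a simplicial map $\phi:(K^n)^{(M)}\to K^{(N)}$ such that $$G=|\iota|^N\circ|\phi|\circ(|\iota|^M)^{-1}\circ(|\pi|^n)^{-1}.$$ Let $\langle F_t:t\in T\rangle$ be a similarity type (a set of operation symbols, each with a finite arity $n_t\ge0$), and let $\Sigma$ be a set of equations $\sigma\approx\tau$ between terms of this type in the variables $x_0,x_1,\dots$. For a metric space $(A,d)$ and an algebra $\mathbf A=(A,\overline F_t)_{t\in T}$, let $$\lambda_{\mathbf A}(\Sigma)=\sup_{\sigma\approx\tau\in\Sigma}\ \sup_{\mathbf a\in A^\omega} d\bigl(\sigma^{\mathbf A}(\mathbf a),\tau^{\mathbf A}(\mathbf a)\bigr)\in[0,\infty],$$ with suprema taken in $[0,\infty]$. Let $\lambda_A(\Sigma)$ be the infimum of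 $\lambda_{\mathbf A}(\Sigma)$ over all algebras $\mathbf A$ on $A$ of this type whose operations are all continuous, and, for $A=|K|$, let $\lambda_A^{\mathrm{simp}}(\Sigma)$ be the infimum of $\lambda_{\mathbf A}(\Sigma)$ over all algebras $\mathbf A$ on $A$ of this type whose operations are all simplicial. The infimum of the empty set is $\infty$. **Statement.** Let $A=|K|$ be the geometric realization of a finite complex $K$ (with any total order on its vertices), and let $\Sigma$ be a finite set of equations. Then $$\lambda_A^{\mathrm{simp}}(\Sigma)=\lambda_A(\Sigma).$$ -/

import Mathlib

universe u v w

noncomputable section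

namespace SimplicialOps

open scoped ENNReal

/-! ### Complexes and geometric realizations

A (simplicial) complex on a set `V` of potential vertices is a `PreAbstractSimplicialComplex V`:
a family of nonempty finite subsets of `V`, closed under passage to nonempty subsets. Its vertices
are the elements of the union of this family. -/

/-- The geometric realization `|K|`: the vectors `α` with nonnegative coordinates of sum `1`
whose carrier (the set of `v` with `α v ≠ 0`, i.e. with `α v > 0`) is a simplex of `K`. -/
@[ext]
structure Realization {V : Type u} (K : PreAbstractSimplicialComplex V) : Type u where
  /-- The coordinate vector. -/
  coord : V →₀ ℝ
  coord_nonneg : ∀ v, 0 ≤ coord v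
  carrier_mem : coord.support ∈ K.faces
  coord_sum : (coord.sum fun _ r => r) = 1

/-- A point of `|K|` as a square summable family, used only to induce the Euclidean metric. -/
def Realization.toLp {V : Type u} {K : PreAbstractSimplicialComplex V} (α : Realization K) :
    lp (fun _ : V => ℝ) 2 :=
  ⟨fun v => α.coord v, (memℓp_zero (by
    refine α.coord.support.finite_toSet.subset fun v hv => ?_
    simpa using hv)).of_exponent_ge zero_le⟩

theorem Realization.toLp_injective {V : Type u} {K : PreAbstractSimplicialComplex V} :
    Function.Injective (Realization.toLp (K := K)) := by
  intro α β h
  refine Realization.ext (Finsupp.ext fun v => ?_)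
  exact congrFun (congrArg Subtype.val h) v

/-- The Euclidean metric of `|K|`; see `Realization.dist_eq` for the explicit formula. -/
instance {V : Type u} (K : PreAbstractSimplicialComplex V) : MetricSpace (Realization K) :=
  MetricSpace.induced Realization.toLp Realization.toLp_injective inferInstance

theorem Realization.dist_eq {V : Type u} {K : PreAbstractSimplicialComplex V}
    (α β : Realization K) :
    dist α β = √(∑ v ∈ (α.coord - β.coord).support, (α.coord v - β.coord v) ^ 2) := by
  change dist α.toLp β.toLp = _
  rw [dist_eq_norm, lp.norm_eq_tsum_rpow (by norm_num), Real.sqrt_eq_rpow]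
  congr 1
  · rw [tsum_eq_sum (s := (α.coord - β.coord).support)]
    · refine Finset.sum_congr rfl fun v _ => ?_
      rw [Real.norm_eq_abs]
      norm_num
      rfl
    · intro v hv
      have h0 : α.coord v - β.coord v = 0 := by simpa using hv
      have h1 : (α.toLp - β.toLp) v = 0 := h0
      simp [h1]

/-- A point of `|K|`, from a vector whose carrier is contained in some simplex of `K`. -/
def Realization.mk' {V : Type u} {K : PreAbstractSimplicialComplex V} (x : V →₀ ℝ)
    (h0 : ∀ v, 0 ≤ x v) (h : ∃ s ∈ K.faces, x.support ⊆ s)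
    (h1 : (x.sum fun _ r => r) = 1) : Realization K where
  coord := x
  coord_nonneg := h0
  carrier_mem := by
    obtain ⟨s, hs, hxs⟩ := h
    refine (K.isRelLowerSet_faces hs).2 hxs ?_
    exact Finsupp.support_nonempty_iff.2 (by rintro rfl; simp at h1)
  coord_sum := h1

/-! ### Simplicial maps -/

open Classical in
/-- A vertex map is simplicial if it sends simplices to simplices. (Only the values of `φ` on
vertices of `K` matter.) -/
def IsSimplicial {V : Type u} {W : Type v} (K : PreAbstractSimplicialComplex V)
    (L : PreAbstractSimplicialComplex W) (φ : V → W) : Prop :=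
  ∀ s ∈ K.faces, s.image φ ∈ L.faces

/-- The geometric realization `|φ|` of a simplicial map: `∑ α_v v* ↦ ∑ α_v φ(v)*`. -/
def Realization.map {V : Type u} {W : Type v} {K : PreAbstractSimplicialComplex V}
    {L : PreAbstractSimplicialComplex W} (φ : V → W) (hφ : IsSimplicial K L φ)
    (α : Realization K) : Realization L :=
  Realization.mk' (α.coord.mapDomain φ)
    (by
      intro w
      rw [Finsupp.mapDomain, Finsupp.sum_apply]
      exact Finset.sum_nonneg fun v _ =>
        Finsupp.single_nonneg.2 (α.coord_nonneg v) w)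
    ⟨_, hφ _ α.carrier_mem, by
      classical convert Finsupp.mapDomain_support (f := φ) (s := α.coord)⟩
    (by
      rw [Finsupp.sum_mapDomain_index (fun _ => rfl) (fun _ _ _ => rfl)]
      exact α.coord_sum)

/-! ### Barycentric subdivision -/

/-- The barycentric subdivision `K'`. The barycenter `b(s)` of a simplex `s` of `K` is represented
by `s` itself, so that the vertices of `K'` are the simplices of `K`, and the simplices of `K'` are
the nonempty finite sets of simplices of `K` that form a chain under inclusion. -/
def barycentric {V : Type u} (K : PreAbstractSimplicialComplex V) :
    PreAbstractSimplicialComplex (Finset V) where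
  faces := {Γ | Γ.Nonempty ∧ (∀ s ∈ Γ, s ∈ K.faces) ∧ ∀ s ∈ Γ, ∀ t ∈ Γ, s ⊆ t ∨ t ⊆ s}
  isRelLowerSet_faces := fun {_Γ} h =>
    ⟨h.1, fun _Δ hΔ hne =>
      ⟨hne, fun s hs => h.2.1 s (hΔ hs), fun s hs t ht => h.2.2 s (hΔ hs) t (hΔ ht)⟩⟩

/-- The barycenter `b(s)`, as a vector: coordinate `1 / |s|` at the elements of `s`, `0` elsewhere. -/
def barycenter {V : Type u} (s : Finset V) : V →₀ ℝ :=
  ∑ v ∈ s, Finsupp.single v (1 / (s.card : ℝ))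

theorem barycenter_nonneg {V : Type u} (s : Finset V) (v : V) : 0 ≤ barycenter s v := by
  classical
  rw [barycenter, Finsupp.finsetSum_apply]
  refine Finset.sum_nonneg fun w _ => ?_
  rw [Finsupp.single_apply]
  split_ifs <;> positivity

theorem barycenter_support {V : Type u} (s : Finset V) : (barycenter s).support ⊆ s := by
  classical
  intro v hv
  by_contra hvs
  refine (Finsupp.mem_support_iff.1 hv) ?_
  rw [barycenter, Finsupp.finsetSum_apply]
  refine Finset.sum_eq_zero fun w hw => ?_
  rw [Finsupp.single_apply, if_neg]
  rintro rfl
  exact hvs hw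

theorem barycenter_sum {V : Type u} {s : Finset V} (hs : s.Nonempty) :
    ((barycenter s).sum fun _ r => r) = 1 := by
  classical
  have hc : (s.card : ℝ) ≠ 0 := by exact_mod_cast hs.card_pos.ne'
  rw [barycenter, ← Finsupp.sum_finsetSum_index (fun _ => rfl) (fun _ _ _ => rfl)]
  simp [hc]

/-- The canonical map `|ι| : |K'| → |K|`, the affine extension of `b(s)* ↦ b(s)`, i.e.
`∑ α_s b(s)* ↦ ∑ α_s b(s)`. (It is a homeomorphism.) -/
def barycentricMap {V : Type u} {K : PreAbstractSimplicialComplex V}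
    (α : Realization (barycentric K)) : Realization K :=
  Realization.mk' (α.coord.sum fun s r => r • barycenter s)
    (by
      intro v
      rw [Finsupp.sum_apply]
      exact Finset.sum_nonneg fun s _ => mul_nonneg (α.coord_nonneg s) (barycenter_nonneg s v))
    (by
      obtain ⟨hne, hK, hch⟩ := α.carrier_mem
      obtain ⟨t, ht, hmax⟩ := Finset.exists_max_image α.coord.support Finset.card hne
      have hsub : ∀ s ∈ α.coord.support, s ⊆ t := by
        intro s hs
        rcases hch s hs t ht with h | h
        · exact h
        · exact (Finset.eq_of_subset_of_card_le h (hmax s hs)).ge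
      refine ⟨t, hK t ht, fun v hv => ?_⟩
      by_contra hvt
      refine (Finsupp.mem_support_iff.1 hv) ?_
      rw [Finsupp.sum_apply]
      refine Finset.sum_eq_zero fun s hs => ?_
      have h0 : barycenter s v = 0 := by
        by_contra h
        exact hvt (hsub s hs (barycenter_support s (Finsupp.mem_support_iff.2 h)))
      simp [h0])
    (by
      rw [Finsupp.sum_sum_index (fun _ => rfl) (fun _ _ _ => rfl)]
      refine (Finset.sum_congr rfl fun s hs => ?_).trans α.coord_sum
      change ((α.coord s • barycenter s).sum fun _ r => r) = α.coord s
      rw [Finsupp.sum_smul_index (fun _ => rfl), ← Finsupp.mul_sum,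
        barycenter_sum (K.isRelLowerSet_faces (α.carrier_mem.2.1 s hs)).1, mul_one])

/-- The type carrying the vertices of the `m`-th barycentric subdivision. -/
def SubdivVertex (V : Type u) : ℕ → Type u
  | 0 => V
  | m + 1 => Finset (SubdivVertex V m)

/-- The `m`-th barycentric subdivision `K^(m)`. -/
def subdiv {V : Type u} (K : PreAbstractSimplicialComplex V) :
    (m : ℕ) → PreAbstractSimplicialComplex (SubdivVertex V m)
  | 0 => K
  | m + 1 => barycentric (subdiv K m)

/-- The composite `|ι|^m : |K^(m)| → |K|`. -/
def subdivMap {V : Type u} (K : PreAbstractSimplicialComplex V) :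
    (m : ℕ) → Realization (subdiv K m) → Realization K
  | 0 => fun α => α
  | m + 1 => fun α => subdivMap K m (barycentricMap α)

/-! ### Powers of a complex -/

/-- The power `K^n` with respect to a total order on the vertices. The vertices are `n`-tuples of
vertices, and the simplices are the nonempty finite sets of `n`-tuples that are chains for the
coordinatewise order and all of whose `n` coordinate projections are simplices of `K`. For `n = 0`
this is the one-point complex. -/
def power {V : Type u} [LinearOrder V] (K : PreAbstractSimplicialComplex V) (n : ℕ) :
    PreAbstractSimplicialComplex (Fin n → V) where
  faces := {s | s.Nonempty ∧ (∀ x ∈ s, ∀ y ∈ s, x ≤ y ∨ y ≤ x) ∧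
    ∀ i : Fin n, s.image (fun x => x i) ∈ K.faces}
  isRelLowerSet_faces := fun {_s} h =>
    ⟨h.1, fun _t ht hne =>
      ⟨hne, fun x hx y hy => h.2.1 x (ht hx) y (ht hy), fun i =>
        (K.isRelLowerSet_faces (h.2.2 i)).2 (Finset.image_subset_image ht) (hne.image _)⟩⟩

theorem isSimplicial_proj {V : Type u} [LinearOrder V] (K : PreAbstractSimplicialComplex V)
    (n : ℕ) (i : Fin n) : IsSimplicial (power K n) K (fun x => x i) :=
  fun _ hs => by convert hs.2.2 i

/-- The canonical map `|π|^n : |K^n| → |K|^n`, whose `i`-th component is the realization of the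
`i`-th projection. (It is a homeomorphism.) -/
def powerMap {V : Type u} [LinearOrder V] (K : PreAbstractSimplicialComplex V) (n : ℕ)
    (α : Realization (power K n)) : Fin n → Realization K :=
  fun i => Realization.map (fun x => x i) (isSimplicial_proj K n i) α

/-- An operation `G : |K|^n → |K|` is simplicial if for some positive `M` and `N` and some
simplicial map `φ : (K^n)^(M) → K^(N)` it is `|ι|^N ∘ |φ| ∘ (|ι|^M)⁻¹ ∘ (|π|^n)⁻¹`. As `|ι|^M` and
`|π|^n` are bijections, this is written as `G ∘ |π|^n ∘ |ι|^M = |ι|^N ∘ |φ|`. -/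
def IsSimplicialOperation {V : Type u} [LinearOrder V] (K : PreAbstractSimplicialComplex V)
    {n : ℕ} (G : (Fin n → Realization K) → Realization K) : Prop :=
  ∃ M N : ℕ, 0 < M ∧ 0 < N ∧
    ∃ (φ : SubdivVertex (Fin n → V) M → SubdivVertex V N)
      (hφ : IsSimplicial (subdiv (power K n) M) (subdiv K N) φ),
      ∀ α : Realization (subdiv (power K n) M),
        G (powerMap K n (subdivMap (power K n) M α)) = subdivMap K N (Realization.map φ hφ α)

/-! ### Approximate satisfaction of equations

A similarity type is an algebraic first-order language `L`, the terms are those in the variables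
`x_0, x_1, …`, an algebra on `A` is an `L`-structure on `A`, and an equation `σ ≈ τ` is a pair of
terms. -/

/-- `λ_𝐀(σ, τ)`, the supremum of the distances of the values of `σ` and `τ` in the algebra `S`. -/
def lambdaPair {L : FirstOrder.Language.{v, w}} {A : Type u} [MetricSpace A] (S : L.Structure A)
    (σ τ : L.Term ℕ) : ℝ≥0∞ :=
  letI := S
  ⨆ a : ℕ → A, edist (σ.realize a) (τ.realize a)

/-- `λ_𝐀(E)` for a set `E` of equations. -/
def lambdaAlg {L : FirstOrder.Language.{v, w}} {A : Type u} [MetricSpace A] (S : L.Structure A)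
    (E : Set (L.Term ℕ × L.Term ℕ)) : ℝ≥0∞ :=
  ⨆ e ∈ E, lambdaPair S e.1 e.2

/-- `λ_A(E)`: the infimum of `λ_𝐀(E)` over all algebras on `A` with continuous operations. -/
def lambda {L : FirstOrder.Language.{v, w}} (A : Type u) [MetricSpace A]
    (E : Set (L.Term ℕ × L.Term ℕ)) : ℝ≥0∞ :=
  ⨅ (S : L.Structure A)
    (_ : ∀ (n : ℕ) (f : L.Functions n), Continuous fun x : Fin n → A => S.funMap f x),
    lambdaAlg S E

/-- `λ_A^simp(E)` for `A = |K|`: the infimum of `λ_𝐀(E)` over all algebras on `A` with simplicial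
operations. -/
def lambdaSimp {L : FirstOrder.Language.{v, w}} {V : Type u} [LinearOrder V]
    (K : PreAbstractSimplicialComplex V) (E : Set (L.Term ℕ × L.Term ℕ)) : ℝ≥0∞ :=
  ⨅ (S : L.Structure (Realization K))
    (_ : ∀ (n : ℕ) (f : L.Functions n),
      IsSimplicialOperation K fun x : Fin n → Realization K => S.funMap f x),
    lambdaAlg S E

end SimplicialOps

end

/-! One inequality says that simplicial operations are continuous. The other says that, on the
compact space $|K|$, continuous operations are uniform limits of simplicial ones and $\lambda$ is
upper semicontinuous under uniform perturbation of the operations, provided the set of equations is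
finite.

Density is simplicial approximation (`exists_simplicial_approximation`), applied to $G\circ|\pi|^n$
on the finite complex $K^n$. Subdividing the target makes a map within one simplex of $G$ uniformly
close to $G$; subdividing the source below a Lebesgue number of the cover by pulled-back open stars
makes a simplicial vertex map available. Both use that the mesh of $K^{(m)}$ tends to $0$
(`exists_subdiv_mesh_lt`), by the contraction factor $1-1/d$ of `dist_barycenter_le`.

Semicontinuity (`exists_lambdaAlg_le`) comes from uniform continuity of the original operations, by
induction on terms (`exists_realize_near`).

The canonical maps $|\iota|$ and $|\pi|^n$ must also be shown bijective. Injectivity of both rests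
on `eq_of_chain_of_weights_eq`; surjectivity is a greedy construction in each case
(`exists_chain_combination_barycenter`, `exists_chain_coupling`). -/

noncomputable section

namespace SimplicialOps

open Filter Topology

open scoped ENNReal

/-! ### The topology of the realization of a finite complex -/

section Realization

variable {V : Type u} {K : PreAbstractSimplicialComplex V}

/-- Finitely supported vectors as square summable families. -/
def finsuppToLp (V : Type u) : (V →₀ ℝ) →ₗ[ℝ] lp (fun _ : V => ℝ) 2 where
  toFun x := ⟨fun v => x v, (memℓp_zero (by
    refine x.support.finite_toSet.subset fun v hv => ?_
    simpa using hv)).of_exponent_ge zero_le⟩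
  map_add' _ _ := rfl
  map_smul' _ _ := rfl

theorem Realization.dist_eq_dist_finsuppToLp (α β : Realization K) :
    dist α β = dist (finsuppToLp V α.coord) (finsuppToLp V β.coord) := rfl

theorem exists_finset_support_subset (hK : K.faces.Finite) :
    ∃ W : Finset V, ∀ s ∈ K.faces, s ⊆ W := by
  classical
  exact ⟨hK.toFinset.biUnion id, fun s hs =>
    Finset.subset_biUnion_of_mem id (hK.mem_toFinset.2 hs)⟩

theorem exists_card_le (hK : K.faces.Finite) : ∃ d : ℕ, 0 < d ∧ ∀ s ∈ K.faces, s.card ≤ d := by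
  obtain ⟨W, hW⟩ := exists_finset_support_subset hK
  -- The extra `1` keeps the bound positive when the complex has no faces.
  exact ⟨W.card + 1, by omega, fun s hs => (Finset.card_le_card (hW s hs)).trans (by omega)⟩

theorem Realization.dist_eq_of_subset {W : Finset V} (hW : ∀ s ∈ K.faces, s ⊆ W)
    (α β : Realization K) : dist α β = √(∑ v ∈ W, (α.coord v - β.coord v) ^ 2) := by
  classical
  rw [Realization.dist_eq]
  congr 1
  refine Finset.sum_subset ?_ ?_
  · intro v hv
    by_contra h
    have h1 : α.coord v = 0 := Finsupp.notMem_support_iff.1 fun h' => h (hW _ α.carrier_mem h')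
    have h2 : β.coord v = 0 := Finsupp.notMem_support_iff.1 fun h' => h (hW _ β.carrier_mem h')
    simp [h1, h2] at hv
  · intro v _ hv
    have h0 : α.coord v - β.coord v = 0 := by simpa using hv
    simp [h0]

theorem Realization.abs_coord_sub_le (α β : Realization K) (v : V) :
    |α.coord v - β.coord v| ≤ dist α β := by
  rw [Realization.dist_eq]
  by_cases hv : v ∈ (α.coord - β.coord).support
  · refine Real.abs_le_sqrt ?_
    exact Finset.single_le_sum (f := fun v => (α.coord v - β.coord v) ^ 2)
      (fun _ _ => sq_nonneg _) hv
  · have h0 : α.coord v - β.coord v = 0 := by simpa using hv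
    rw [h0, abs_zero]
    exact Real.sqrt_nonneg _

theorem Realization.continuous_coord (v : V) :
    Continuous fun α : Realization K => α.coord v := by
  refine (LipschitzWith.of_dist_le_mul (K := 1) fun α β => ?_).continuous
  simpa [Real.dist_eq] using α.abs_coord_sub_le β v

/-- All carriers lie in one finite set, so the distance is a fixed finite sum over coordinates. -/
theorem Realization.continuous_of_coord {X : Type*} [TopologicalSpace X] (hK : K.faces.Finite)
    {f : X → Realization K} (hf : ∀ v, Continuous fun x => (f x).coord v) : Continuous f := by
  obtain ⟨W, hW⟩ := exists_finset_support_subset hK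
  refine continuous_iff_continuousAt.2 fun x => ?_
  rw [ContinuousAt, tendsto_iff_dist_tendsto_zero]
  simp only [Realization.dist_eq_of_subset hW]
  have hc : Continuous fun y => √(∑ v ∈ W, ((f y).coord v - (f x).coord v) ^ 2) :=
    (continuous_finsetSum _ fun v _ => ((hf v).sub continuous_const).pow 2).sqrt
  simpa using hc.tendsto x

/-- The points of the standard simplex spanned by the finite set `s`. -/
def simplexPoints (s : Finset V) : Set (V → ℝ) :=
  {x | (∀ v, x v ∈ Set.Icc (0 : ℝ) 1) ∧ (∀ v ∉ s, x v = 0) ∧ ∑ v ∈ s, x v = 1}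

/-- A closed subset of a cube in the product topology, so Tychonoff applies even if `V` is infinite.
-/
theorem isCompact_simplexPoints (s : Finset V) : IsCompact (simplexPoints s) := by
  have h1 : IsCompact (Set.univ.pi fun _ : V => Set.Icc (0 : ℝ) 1) :=
    isCompact_univ_pi fun _ => isCompact_Icc
  refine h1.of_isClosed_subset ?_ fun x hx v _ => hx.1 v
  refine IsClosed.inter ?_ (IsClosed.inter ?_ ?_)
  · change IsClosed {x : V → ℝ | ∀ v, x v ∈ Set.Icc (0 : ℝ) 1}
    simp only [Set.ofPred_forall]
    exact isClosed_iInter fun v => isClosed_Icc.preimage (continuous_apply v)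
  · change IsClosed {x : V → ℝ | ∀ v ∉ s, x v = 0}
    simp only [Set.ofPred_forall]
    exact isClosed_iInter fun v => isClosed_iInter fun _ =>
      isClosed_eq (continuous_apply v) continuous_const
  · exact isClosed_eq (continuous_finsetSum _ fun v _ => continuous_apply v) continuous_const

theorem Realization.coord_le_one (α : Realization K) (v : V) : α.coord v ≤ 1 := by
  by_cases hv : v ∈ α.coord.support
  · rw [← α.coord_sum]
    exact Finset.single_le_sum (fun v _ => α.coord_nonneg v) hv
  · rw [Finsupp.notMem_support_iff.1 hv]
    exact zero_le_one

/-- The points of the simplex spanned by a face, as points of the realization. -/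
def simplexInclusion {s : Finset V} (hs : s ∈ K.faces) (x : simplexPoints s) : Realization K :=
  Realization.mk'
    (Finsupp.onFinset s x.1 fun v hv => by
      by_contra h
      exact hv (x.2.2.1 v h))
    (fun v => (x.2.1 v).1) ⟨s, hs, Finsupp.support_onFinset_subset⟩
    (by
      rw [Finsupp.onFinset_sum _ fun _ => rfl]
      exact x.2.2.2)

/-- $|K|$ is a finite union of continuous images of compact simplices. -/
theorem compactSpace_realization (hK : K.faces.Finite) : CompactSpace (Realization K) := by
  have : Finite K.faces := hK
  have hcov : (⋃ s : K.faces, Set.range (simplexInclusion s.2)) =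
      (Set.univ : Set (Realization K)) := by
    refine Set.eq_univ_of_forall fun α => Set.mem_iUnion.2 ⟨⟨_, α.carrier_mem⟩, ?_⟩
    refine ⟨⟨fun v => α.coord v, fun v => ⟨α.coord_nonneg v, α.coord_le_one v⟩,
      fun v hv => Finsupp.notMem_support_iff.1 hv, α.coord_sum⟩, ?_⟩
    exact Realization.ext (Finsupp.ext fun _ => rfl)
  refine ⟨hcov ▸ isCompact_iUnion fun s => ?_⟩
  have := isCompact_iff_compactSpace.1 (isCompact_simplexPoints s.1)
  refine isCompact_range (Realization.continuous_of_coord hK fun v => ?_)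
  exact (continuous_apply v).comp continuous_subtype_val

end Realization

/-! ### The canonical maps are homeomorphisms -/

/-- A finitely supported family of nonnegative weights whose support is a chain for the preorder
defined by a separating family of sets is determined by the weights of these sets. -/
theorem eq_of_chain_of_weights_eq {P I : Type*} [DecidableEq P] [PartialOrder P] (A : I → Set P)
    [∀ i, DecidablePred (· ∈ A i)] (hA : ∀ y z, y ≤ z ↔ ∀ i, y ∈ A i → z ∈ A i) {a b : P →₀ ℝ}
    (ha0 : ∀ y, 0 ≤ a y) (hb0 : ∀ y, 0 ≤ b y)
    (ha : ∀ y ∈ a.support, ∀ z ∈ a.support, y ≤ z ∨ z ≤ y)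
    (hb : ∀ y ∈ b.support, ∀ z ∈ b.support, y ≤ z ∨ z ≤ y)
    (hne : ∀ y ∈ a.support ∪ b.support, ∃ i, y ∈ A i)
    (hab : ∀ i, ∑ y ∈ a.support with y ∈ A i, a y = ∑ y ∈ b.support with y ∈ A i, b y) :
    a = b := by
  classical
  -- the weight of the set of points above `t` is the least weight of a set containing `t`
  have key : ∀ (a b : P →₀ ℝ), (∀ y, 0 ≤ b y) →
      (∀ y ∈ a.support, ∀ z ∈ a.support, y ≤ z ∨ z ≤ y) →
      (∀ i, ∑ y ∈ a.support with y ∈ A i, a y = ∑ y ∈ b.support with y ∈ A i, b y) →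
      ∀ t, (∃ i, t ∈ A i) → ∑ y ∈ b.support with t ≤ y, b y ≤
        ∑ y ∈ a.support with t ≤ y, a y := by
    intro a b hb0 ha hab t ht
    -- Some `A i` meets the support of `a` exactly in the points above `t`. Otherwise take `z`
    -- maximal in the support among points not above `t`, a set `A j` containing `t` but not `z`,
    -- and a point `x` of the support in `A j` not above `t`. Comparing `x` with `z` in the chain
    -- forces `z ∈ A j`.
    obtain ⟨i, hti, hi⟩ : ∃ i, t ∈ A i ∧ ∀ y ∈ a.support, y ∈ A i → t ≤ y := by
      by_contra! hcon
      obtain ⟨i₀, hi₀⟩ := ht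
      obtain ⟨y, hy, -, hy'⟩ := hcon i₀ hi₀
      obtain ⟨z, hz⟩ := (a.support.filter fun y => ¬ t ≤ y).exists_maximal
        ⟨y, Finset.mem_filter.2 ⟨hy, hy'⟩⟩
      obtain ⟨hz', hzt⟩ := Finset.mem_filter.1 hz.prop
      rw [hA] at hzt
      push Not at hzt
      obtain ⟨j, htj, hzj⟩ := hzt
      obtain ⟨x, hx, hxj, hxt⟩ := hcon j htj
      rcases ha x hx z hz' with h | h
      · exact hzj ((hA _ _).1 h j hxj)
      · exact hzj ((hA _ _).1 (hz.2 (Finset.mem_filter.2 ⟨hx, hxt⟩) h) j hxj)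
    calc ∑ y ∈ b.support with t ≤ y, b y
        ≤ ∑ y ∈ b.support with y ∈ A i, b y := by
          refine Finset.sum_le_sum_of_subset_of_nonneg ?_ fun _ _ _ => hb0 _
          intro y hy
          simp only [Finset.mem_filter] at hy ⊢
          exact ⟨hy.1, (hA _ _).1 hy.2 i hti⟩
      _ = ∑ y ∈ a.support with y ∈ A i, a y := (hab i).symm
      _ = _ := by
          refine Finset.sum_congr (Finset.filter_congr fun y hy => ?_) fun _ _ => rfl
          exact ⟨fun h => hi y hy h, fun h => (hA _ _).1 h i hti⟩
  have hext : ∀ (c : P →₀ ℝ) (t : P), c.support ⊆ a.support ∪ b.support →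
      ∑ y ∈ c.support with t ≤ y, c y = ∑ y ∈ a.support ∪ b.support with t ≤ y, c y := by
    intro c t hc
    rw [Finset.sum_filter, Finset.sum_filter]
    refine Finset.sum_subset hc fun y _ hy => ?_
    rw [Finsupp.notMem_support_iff.1 hy, ite_self]
  by_contra hne'
  obtain ⟨x, hx⟩ : ∃ x, a x ≠ b x := by
    by_contra! h
    exact hne' (Finsupp.ext h)
  have hmem : ∀ x, a x ≠ b x → x ∈ a.support ∪ b.support := by
    intro x hx
    by_contra h
    simp only [Finset.mem_union, Finsupp.mem_support_iff, not_or, not_not] at h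
    exact hx (h.1.trans h.2.symm)
  -- At a maximal `t` where `a` and `b` differ, they agree strictly above `t`, so equality of the
  -- weights above `t` leaves only the term at `t`.
  obtain ⟨t, ht⟩ := ((a.support ∪ b.support).filter fun x => a x ≠ b x).exists_maximal
    ⟨x, Finset.mem_filter.2 ⟨hmem x hx, hx⟩⟩
  obtain ⟨ht', htab⟩ := Finset.mem_filter.1 ht.prop
  have h1 := le_antisymm (key a b hb0 ha hab t (hne t ht'))
    (key b a ha0 hb (fun i => (hab i).symm) t (hne t ht'))
  rw [hext a t Finset.subset_union_left, hext b t Finset.subset_union_right, eq_comm,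
    ← sub_eq_zero, ← Finset.sum_sub_distrib, Finset.sum_eq_single t] at h1
  · exact htab (sub_eq_zero.1 h1)
  · intro y hy hyt
    obtain ⟨hy, hty⟩ := Finset.mem_filter.1 hy
    by_contra h
    exact hyt (le_antisymm
      (ht.2 (Finset.mem_filter.2 ⟨hy, fun h' => h (sub_eq_zero.2 h')⟩) hty) hty)
  · intro h
    exact absurd (Finset.mem_filter.2 ⟨ht', le_rfl⟩) h

/-! ### Bijectivity and continuity of the barycentric map. -/

section Barycentric

variable {V : Type u} {K : PreAbstractSimplicialComplex V}

theorem barycenter_apply [DecidableEq V] (s : Finset V) (v : V) :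
    barycenter s v = if v ∈ s then 1 / (s.card : ℝ) else 0 := by
  rw [barycenter, Finsupp.finsetSum_apply]
  simp [Finsupp.single_apply]

theorem finite_faces_barycentric (hK : K.faces.Finite) : (barycentric K).faces.Finite := by
  refine (hK.toFinset.powerset.finite_toSet).subset fun Γ hΓ => ?_
  simp only [Finset.coe_powerset, Set.mem_preimage, Set.mem_powerset_iff]
  intro s hs
  simpa using hΓ.2.1 s hs

/-- With $c_s=\alpha_s/|s|$, the coordinate of the image at $v$ is the total weight $c$ of the
simplices containing $v$. These weights determine $c$, since its support is a chain. -/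
theorem barycentricMap_injective :
    Function.Injective (barycentricMap (K := K)) := by
  classical
  have hw : ∀ α : Realization (barycentric K), ∃ c : Finset V →₀ ℝ, (∀ s, 0 ≤ c s) ∧
      c.support ⊆ α.coord.support ∧ (∀ s, α.coord s = c s * s.card) ∧
      ∀ v, ∑ s ∈ c.support with v ∈ s, c s = (barycentricMap α).coord v := by
    intro α
    have hsupp : (Finsupp.onFinset α.coord.support (fun s => α.coord s / s.card) fun s hs =>
        Finsupp.mem_support_iff.2 fun h => hs (by rw [h, zero_div])).support ⊆
        α.coord.support := Finsupp.support_onFinset_subset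
    refine ⟨_, fun s => ?_, hsupp, fun s => ?_, fun v => ?_⟩
    · exact div_nonneg (α.coord_nonneg s) (Nat.cast_nonneg _)
    · rw [Finsupp.onFinset_apply]
      by_cases hs : s ∈ α.coord.support
      · have hne := (K.isRelLowerSet_faces (α.carrier_mem.2.1 s hs)).1
        have : (s.card : ℝ) ≠ 0 := by exact_mod_cast hne.card_pos.ne'
        field_simp
      · rw [Finsupp.notMem_support_iff.1 hs, zero_div, zero_mul]
    · change _ = (α.coord.sum fun s r => r • barycenter s) v
      rw [Finsupp.sum_apply, Finset.sum_filter, Finsupp.sum]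
      refine (Finset.sum_subset hsupp fun s _ hs => ?_).trans (Finset.sum_congr rfl fun s _ => ?_)
      · rw [Finsupp.notMem_support_iff.1 hs, ite_self]
      · rw [Finsupp.onFinset_apply, Finsupp.smul_apply, barycenter_apply]
        split_ifs <;> simp [div_eq_mul_inv]
  intro α β h
  obtain ⟨a, ha0, has, hαa, hax⟩ := hw α
  obtain ⟨b, hb0, hbs, hβb, hbx⟩ := hw β
  have hab : a = b := by
    refine eq_of_chain_of_weights_eq (fun v : V => {s : Finset V | v ∈ s}) (fun _ _ => Iff.rfl)
      ha0 hb0 (fun s hs t ht => α.carrier_mem.2.2 s (has hs) t (has ht))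
      (fun s hs t ht => β.carrier_mem.2.2 s (hbs hs) t (hbs ht)) ?_ ?_
    · intro s hs
      rcases Finset.mem_union.1 hs with hs | hs
      · exact (K.isRelLowerSet_faces (α.carrier_mem.2.1 s (has hs))).1
      · exact (K.isRelLowerSet_faces (β.carrier_mem.2.1 s (hbs hs))).1
    · intro v
      exact (hax v).trans ((congrArg (fun γ => γ.coord v) h).trans (hbx v).symm)
  exact Realization.ext (Finsupp.ext fun s => by rw [hαa, hβb, hab])

/-- Peel off the least positive coordinate times the indicator of the carrier, a multiple of a
barycenter. The carrier shrinks, so all later simplices lie inside the earlier ones. -/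
theorem exists_chain_combination_barycenter (x : V →₀ ℝ) (hx : ∀ v, 0 ≤ x v) :
    ∃ a : Finset V →₀ ℝ, (∀ s, 0 ≤ a s) ∧
      (∀ s ∈ a.support, s.Nonempty ∧ s ⊆ x.support) ∧
      (∀ s ∈ a.support, ∀ t ∈ a.support, s ⊆ t ∨ t ⊆ s) ∧
      (a.sum fun s r => r • barycenter s) = x := by
  classical
  induction hn : x.support.card using Nat.strong_induction_on generalizing x with
  | _ n ih =>
  subst hn
  rcases x.support.eq_empty_or_nonempty with h0 | hne
  · exact ⟨0, fun _ => le_rfl, by simp, by simp, by simpa using (Finsupp.support_eq_empty.1 h0).symm⟩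
  obtain ⟨u, hu, hmin⟩ := Finset.exists_min_image x.support x hne
  have hc : (x.support.card : ℝ) ≠ 0 := by exact_mod_cast hne.card_pos.ne'
  set b : V →₀ ℝ := (x u * x.support.card) • barycenter x.support with hb
  have hbv : ∀ v, b v = if v ∈ x.support then x u else 0 := by
    intro v
    rw [hb, Finsupp.smul_apply, barycenter_apply]
    split_ifs
    · simp [hc]
    · simp
  have hu0 : 0 < x u := lt_of_le_of_ne (hx u) (Finsupp.mem_support_iff.1 hu).symm
  have hsub : (x - b).support ⊆ x.support.erase u := by
    intro v hv
    rw [Finsupp.mem_support_iff, Finsupp.sub_apply, hbv] at hv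
    rw [Finset.mem_erase]
    by_cases hvx : v ∈ x.support
    · refine ⟨?_, hvx⟩
      rintro rfl
      simp [hvx] at hv
    · rw [if_neg hvx, Finsupp.notMem_support_iff.1 hvx] at hv
      simp at hv
  obtain ⟨a, ha0, has, hach, hax⟩ := ih _
    ((Finset.card_le_card hsub).trans_lt (Finset.card_erase_lt_of_mem hu)) (x - b) (by
      intro v
      rw [Finsupp.sub_apply, hbv]
      split_ifs with h
      · exact sub_nonneg.2 (hmin v h)
      · simpa using hx v) rfl
  have hsupp : ∀ s ∈ (a + Finsupp.single x.support (x u * x.support.card)).support,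
      s = x.support ∨ s ∈ a.support := by
    intro s hs
    rcases Finset.mem_union.1 (Finsupp.support_add hs) with h | h
    · exact Or.inr h
    · exact Or.inl (Finset.mem_singleton.1 (Finsupp.support_single_subset h))
  have has' : ∀ s ∈ a.support, s ⊆ x.support := fun s hs =>
    ((has s hs).2.trans hsub).trans (Finset.erase_subset _ _)
  refine ⟨a + Finsupp.single x.support (x u * x.support.card), ?_, ?_, ?_, ?_⟩
  · intro s
    exact add_nonneg (ha0 s) (Finsupp.single_nonneg.2 (by positivity) s)
  · intro s hs
    rcases hsupp s hs with rfl | h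
    · exact ⟨hne, subset_rfl⟩
    · exact ⟨(has s h).1, has' s h⟩
  · intro s hs t ht
    rcases hsupp s hs with rfl | hs
    · rcases hsupp t ht with rfl | ht
      · exact Or.inl subset_rfl
      · exact Or.inr (has' t ht)
    · rcases hsupp t ht with rfl | ht
      · exact Or.inl (has' s hs)
      · exact hach s hs t ht
  · rw [Finsupp.sum_add_index' (h := fun s r => r • barycenter s) (fun _ => zero_smul _ _)
      (fun _ _ _ => add_smul _ _ _), hax,
      Finsupp.sum_single_index (h := fun s r => r • barycenter s) (zero_smul _ _)]
    exact sub_add_cancel x b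

theorem sum_smul_barycenter_sum {a : Finset V →₀ ℝ} (ha : ∀ s ∈ a.support, s.Nonempty) :
    ((a.sum fun s r => r • barycenter s).sum fun _ r => r) = a.sum fun _ r => r := by
  rw [Finsupp.sum_sum_index (fun _ => rfl) (fun _ _ _ => rfl)]
  refine Finset.sum_congr rfl fun s hs => ?_
  change ((a s • barycenter s).sum fun _ r => r) = a s
  rw [Finsupp.sum_smul_index (fun _ => rfl), ← Finsupp.mul_sum, barycenter_sum (ha s hs), mul_one]

theorem barycentricMap_surjective :
    Function.Surjective (barycentricMap (K := K)) := by
  intro x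
  obtain ⟨a, ha0, has, hach, hax⟩ := exists_chain_combination_barycenter x.coord x.coord_nonneg
  have hsum : (a.sum fun _ r => r) = 1 := by
    rw [← sum_smul_barycenter_sum fun s hs => (has s hs).1, hax, x.coord_sum]
  refine ⟨⟨a, ha0, ⟨?_, fun s hs => ?_, hach⟩, hsum⟩, Realization.ext hax⟩
  · exact Finsupp.support_nonempty_iff.2 (by rintro rfl; simp at hsum)
  · exact (K.isRelLowerSet_faces x.carrier_mem).2 (has s hs).2 (has s hs).1

theorem continuous_barycentricMap (hK : K.faces.Finite) :
    Continuous (barycentricMap (K := K)) := by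
  obtain ⟨W, hW⟩ := exists_finset_support_subset (finite_faces_barycentric hK)
  refine Realization.continuous_of_coord hK fun v => ?_
  have h : ∀ α : Realization (barycentric K), (barycentricMap α).coord v =
      ∑ s ∈ W, α.coord s * barycenter s v := by
    intro α
    change (α.coord.sum fun s r => r • barycenter s) v = _
    rw [Finsupp.sum_apply, Finsupp.sum_of_support_subset _ (hW _ α.carrier_mem)]
    · rfl
    · simp
  simp only [h]
  exact continuous_finsetSum _ fun s _ => (Realization.continuous_coord s).mul continuous_const

end Barycentric

/-! ### Bijectivity and continuity of the product map. -/

section Power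

variable {V : Type u}

theorem finite_faces_power [LinearOrder V] {K : PreAbstractSimplicialComplex V}
    (hK : K.faces.Finite) (n : ℕ) : (power K n).faces.Finite := by
  obtain ⟨W, hW⟩ := exists_finset_support_subset hK
  refine ((Fintype.piFinset fun _ : Fin n => W).powerset.finite_toSet).subset fun Γ hΓ => ?_
  simp only [Finset.coe_powerset, Set.mem_preimage, Set.mem_powerset_iff]
  intro x hx
  simp only [Finset.mem_coe, Fintype.mem_piFinset]
  exact fun i => hW _ (hΓ.2.2 i) (Finset.mem_image_of_mem _ hx)

theorem continuous_realization_map {W : Type v} {K : PreAbstractSimplicialComplex V}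
    {L : PreAbstractSimplicialComplex W} (hK : K.faces.Finite) (hL : L.faces.Finite) (φ : V → W)
    (hφ : IsSimplicial K L φ) : Continuous (Realization.map φ hφ) := by
  classical
  obtain ⟨S, hS⟩ := exists_finset_support_subset hK
  refine Realization.continuous_of_coord hL fun w => ?_
  have h : ∀ α : Realization K, (Realization.map φ hφ α).coord w =
      ∑ v ∈ S, if φ v = w then α.coord v else 0 := by
    intro α
    change α.coord.mapDomain φ w = _
    rw [Finsupp.mapDomain, Finsupp.sum_apply, Finsupp.sum_of_support_subset _ (hS _ α.carrier_mem)]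
    · simp only [Finsupp.single_apply]
    · simp
  simp only [h]
  refine continuous_finsetSum _ fun v _ => ?_
  split_ifs
  · exact Realization.continuous_coord v
  · exact continuous_const

/-- Nonnegative weights cannot cancel. -/
theorem mapDomain_support_of_nonneg {W : Type v} [DecidableEq W] {a : V →₀ ℝ}
    (ha : ∀ v, 0 ≤ a v) (φ : V → W) : (a.mapDomain φ).support = a.support.image φ := by
  classical
  refine (Finsupp.mapDomain_support.trans (by rfl)).antisymm fun w hw => ?_
  obtain ⟨v, hv, rfl⟩ := Finset.mem_image.1 hw
  rw [Finsupp.mem_support_iff, Finsupp.mapDomain, Finsupp.sum_apply]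
  refine ne_of_gt (Finset.sum_pos' (fun u _ => Finsupp.single_nonneg.2 (ha u) _) ⟨v, hv, ?_⟩)
  change 0 < Finsupp.single (φ v) (a v) (φ v)
  rw [Finsupp.single_eq_same]
  exact lt_of_le_of_ne (ha v) (Finsupp.mem_support_iff.1 hv).symm

variable [LinearOrder V] {K : PreAbstractSimplicialComplex V} {n : ℕ}

theorem continuous_powerMap (hK : K.faces.Finite) : Continuous (powerMap K n) :=
  continuous_pi fun _ => continuous_realization_map (finite_faces_power hK n) hK _ _

/-- The weight of $\{y : u\le y_i\}$ is a tail sum of the $i$-th marginal, and these sets separate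
the coordinatewise order. -/
theorem powerMap_injective : Function.Injective (powerMap K n) := by
  classical
  intro α β h
  have hm : ∀ i, α.coord.mapDomain (fun x => x i) = β.coord.mapDomain (fun x => x i) := fun i =>
    congrArg Realization.coord (congrFun h i)
  have hs : ∀ (a : (Fin n → V) →₀ ℝ) (i : Fin n) (u : V),
      ∑ y ∈ a.support with u ≤ y i, a y =
        (a.mapDomain fun y => y i).sum fun w r => if u ≤ w then r else 0 := by
    intro a i u
    rw [Finsupp.sum_mapDomain_index (by simp) (by intros; split_ifs <;> simp), Finset.sum_filter]
    rfl
  refine Realization.ext (eq_of_chain_of_weights_eq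
    -- The index `none` gives the set of all tuples, so that every tuple lies in some set even for
    -- `n = 0`.
    (fun p : Option (Fin n × V) => {y : Fin n → V | ∀ q ∈ p, q.2 ≤ y q.1}) ?_
    α.coord_nonneg β.coord_nonneg α.carrier_mem.2.1 β.carrier_mem.2.1 ?_ ?_)
  · intro y z
    constructor
    · intro hyz p hy q hq
      exact (hy q hq).trans (hyz q.1)
    · intro hp i
      exact hp (some (i, y i)) (by simp) (i, y i) rfl
  · exact fun y _ => ⟨none, by simp⟩
  · rintro (_ | ⟨i, u⟩)
    · simpa [Finsupp.sum] using α.coord_sum.trans β.coord_sum.symm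
    · have h' := hs α.coord i u
      rw [hm i, ← hs β.coord i u] at h'
      simpa using h'

/-- The monotone coupling of finitely many weights of the same total mass on a linear order. -/
theorem exists_chain_coupling (x : Fin n → V →₀ ℝ) (hx : ∀ i v, 0 ≤ x i v) (c : ℝ) (hc : 0 ≤ c)
    (hxc : ∀ i, ((x i).sum fun _ r => r) = c) :
    ∃ a : (Fin n → V) →₀ ℝ, (∀ y, 0 ≤ a y) ∧ (a.sum fun _ r => r) = c ∧
      (∀ y ∈ a.support, ∀ i, y i ∈ (x i).support) ∧
      (∀ y ∈ a.support, ∀ z ∈ a.support, y ≤ z ∨ z ≤ y) ∧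
      ∀ i, a.mapDomain (fun y => y i) = x i := by
  classical
  induction hN : ∑ i, (x i).support.card using Nat.strong_induction_on generalizing x c with
  | _ N ih =>
  subst hN
  rcases hc.eq_or_lt with rfl | hc
  · refine ⟨0, fun _ => le_rfl, by simp, by simp, by simp, fun i => ?_⟩
    rw [Finsupp.mapDomain_zero]
    ext v
    by_contra hv
    have h1 := Finset.single_le_sum (fun w _ => hx i w)
      (Finsupp.mem_support_iff.2 fun h => hv h.symm)
    exact hv (le_antisymm (hx i v) (h1.trans (hxc i).le))
  have hne : ∀ i, (x i).support.Nonempty := fun i =>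
    Finsupp.support_nonempty_iff.2 (by intro h; have := hxc i; rw [h] at this; simp at this; grind)
  rcases isEmpty_or_nonempty (Fin n) with hn | hn
  · refine ⟨Finsupp.single isEmptyElim c, fun y => Finsupp.single_nonneg.2 hc.le y, by simp,
      fun _ _ i => isEmptyElim i, fun y _ z _ => Or.inl (Subsingleton.elim y z).le,
      fun i => isEmptyElim i⟩
  -- Greedy step: `u` collects the least point of each support, and the smallest mass `m` found
  -- there is moved to the tuple `u`. Coordinate `j` loses a support point, and every tuple used
  -- later lies above `u`.
  set u : Fin n → V := fun i => (x i).support.min' (hne i) with hu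
  have hus : ∀ i, u i ∈ (x i).support := fun i => Finset.min'_mem _ _
  obtain ⟨j, -, hj⟩ := Finset.exists_min_image Finset.univ (fun i => x i (u i))
    Finset.univ_nonempty
  set m : ℝ := x j (u j) with hm
  have hm0 : 0 < m := lt_of_le_of_ne (hx _ _) (Finsupp.mem_support_iff.1 (hus j)).symm
  set x' : Fin n → V →₀ ℝ := fun i => x i - Finsupp.single (u i) m with hx'
  have hx'v : ∀ i v, x' i v = x i v - if u i = v then m else 0 := by
    intro i v
    rw [hx', Finsupp.sub_apply, Finsupp.single_apply]
  have hsub : ∀ i, (x' i).support ⊆ (x i).support := by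
    intro i v hv
    rw [Finsupp.mem_support_iff, hx'v] at hv
    split_ifs at hv with h
    · exact h ▸ hus i
    · simpa using hv
  have hx'c : ∀ i, ((x' i).sum fun _ r => r) = c - m := by
    intro i
    rw [hx', Finsupp.sum_sub_index (h := fun _ r => r) (fun _ _ _ => rfl), hxc,
      Finsupp.sum_single_index rfl]
  have hx'0 : ∀ i v, 0 ≤ x' i v := by
    intro i v
    rw [hx'v]
    split_ifs with h
    · exact h ▸ sub_nonneg.2 (hj i (Finset.mem_univ i))
    · simpa using hx i v
  have hcm : 0 ≤ c - m := by
    rw [← hx'c j]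
    exact Finset.sum_nonneg fun v _ => hx'0 j v
  obtain ⟨a, ha0, hac, has, hach, hax⟩ := ih _
    (Finset.sum_lt_sum (fun i _ => Finset.card_le_card (hsub i)) ⟨j, Finset.mem_univ j,
      Finset.card_lt_card ((Finset.ssubset_iff_of_subset (hsub j)).2 ⟨u j, hus j, by
        simp [hx'v, hm]⟩)⟩) x' hx'0 (c - m) hcm hx'c rfl
  have hsupp : ∀ y ∈ (a + Finsupp.single u m).support, y = u ∨ y ∈ a.support := by
    intro s hs
    rcases Finset.mem_union.1 (Finsupp.support_add hs) with h | h
    · exact Or.inr h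
    · exact Or.inl (Finset.mem_singleton.1 (Finsupp.support_single_subset h))
  have hua : ∀ y ∈ a.support, u ≤ y := fun y hy i =>
    Finset.min'_le _ _ (hsub i (has y hy i))
  refine ⟨a + Finsupp.single u m, ?_, ?_, ?_, ?_, ?_⟩
  · intro y
    exact add_nonneg (ha0 y) (Finsupp.single_nonneg.2 hm0.le y)
  · rw [Finsupp.sum_add_index' (h := fun _ r => r) (fun _ => rfl) (fun _ _ _ => rfl), hac,
      Finsupp.sum_single_index rfl, sub_add_cancel]
  · intro y hy i
    rcases hsupp y hy with rfl | h
    · exact hus i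
    · exact hsub i (has y h i)
  · intro y hy z hz
    rcases hsupp y hy with rfl | hy
    · rcases hsupp z hz with rfl | hz
      · exact Or.inl le_rfl
      · exact Or.inl (hua z hz)
    · rcases hsupp z hz with rfl | hz
      · exact Or.inr (hua y hy)
      · exact hach y hy z hz
  · intro i
    rw [Finsupp.mapDomain_add, hax, Finsupp.mapDomain_single]
    exact sub_add_cancel _ _

theorem powerMap_surjective : Function.Surjective (powerMap K n) := by
  classical
  intro x
  obtain ⟨a, ha0, hac, -, hach, hax⟩ := exists_chain_coupling (fun i => (x i).coord)
    (fun i => (x i).coord_nonneg) 1 zero_le_one fun i => (x i).coord_sum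
  refine ⟨⟨a, ha0, ⟨?_, hach, fun i => ?_⟩, hac⟩, funext fun i => Realization.ext (hax i)⟩
  · exact Finsupp.support_nonempty_iff.2 (by rintro rfl; simp at hac)
  · convert (x i).carrier_mem
    rw [← hax i, mapDomain_support_of_nonneg ha0]

end Power

/-! ### Iterated subdivisions and their mesh -/

section Subdivision

variable {V : Type u}

theorem finite_faces_subdiv {K : PreAbstractSimplicialComplex V} (hK : K.faces.Finite) :
    ∀ m, (subdiv K m).faces.Finite
  | 0 => hK
  | m + 1 => finite_faces_barycentric (finite_faces_subdiv hK m)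

theorem continuous_subdivMap {K : PreAbstractSimplicialComplex V} (hK : K.faces.Finite) :
    ∀ m, Continuous (subdivMap K m)
  | 0 => continuous_id
  | m + 1 => (continuous_subdivMap hK m).comp (continuous_barycentricMap (finite_faces_subdiv hK m))

theorem subdivMap_bijective (K : PreAbstractSimplicialComplex V) :
    ∀ m, Function.Bijective (subdivMap K m)
  | 0 => Function.bijective_id
  | m + 1 => (subdivMap_bijective K m).comp ⟨barycentricMap_injective, barycentricMap_surjective⟩

/-- The homeomorphism `|ι|^m : |K^(m)| ≃ |K|` of a finite complex `K`. -/
def subdivHomeomorph {K : PreAbstractSimplicialComplex V} (hK : K.faces.Finite) (m : ℕ) :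
    Realization (subdiv K m) ≃ₜ Realization K :=
  haveI := compactSpace_realization (finite_faces_subdiv hK m)
  Continuous.homeoOfEquivCompactToT2 (f := Equiv.ofBijective _ (subdivMap_bijective K m))
    (continuous_subdivMap hK m)

/-- The position in `|K|` of a vertex of the `m`-th subdivision. -/
def subdivPoint (V : Type u) : (m : ℕ) → SubdivVertex V m → V →₀ ℝ
  | 0 => fun v => Finsupp.single v 1
  | m + 1 => fun s : Finset (SubdivVertex V m) => Finsupp.linearCombination ℝ (subdivPoint V m)
      (barycenter s)

theorem subdivMap_coord (K : PreAbstractSimplicialComplex V) :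
    ∀ (m : ℕ) (α : Realization (subdiv K m)),
      (subdivMap K m α).coord = Finsupp.linearCombination ℝ (subdivPoint V m) α.coord
  | 0 => fun α => by
      rw [Finsupp.linearCombination_apply]
      change α.coord = α.coord.sum fun v r => r • Finsupp.single v 1
      simp
  | m + 1 => fun α => by
      refine (subdivMap_coord K m (barycentricMap α)).trans ?_
      change Finsupp.linearCombination ℝ (subdivPoint V m)
        (α.coord.sum fun s r => r • barycenter s) = _
      rw [map_finsuppSum, Finsupp.linearCombination_apply]
      simp only [map_smul]
      rfl

theorem linearCombination_mem_convexHull {P E : Type*} [AddCommGroup E] [Module ℝ E] (p : P → E)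
    {a : P →₀ ℝ} (ha : ∀ y, 0 ≤ a y) (ha1 : (a.sum fun _ r => r) = 1) {s : Set P}
    (hs : ↑a.support ⊆ s) : Finsupp.linearCombination ℝ p a ∈ convexHull ℝ (p '' s) := by
  rw [Finsupp.linearCombination_apply]
  exact (convex_convexHull ℝ _).sum_mem (fun y _ => ha y) ha1 fun y hy =>
    subset_convexHull ℝ _ (Set.mem_image_of_mem p (hs hy))

/-- The distance between points of two convex hulls is at most that of some pair of generating
points. -/
theorem dist_linearCombination_le {P E : Type*} [SeminormedAddCommGroup E] [NormedSpace ℝ E]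
    (p : P → E) {a b : P →₀ ℝ} (ha : ∀ y, 0 ≤ a y) (ha1 : (a.sum fun _ r => r) = 1)
    (hb : ∀ y, 0 ≤ b y) (hb1 : (b.sum fun _ r => r) = 1) {D : ℝ}
    (hD : ∀ y ∈ a.support, ∀ z ∈ b.support, dist (p y) (p z) ≤ D) :
    dist (Finsupp.linearCombination ℝ p a) (Finsupp.linearCombination ℝ p b) ≤ D := by
  obtain ⟨_, ⟨y, hy, rfl⟩, _, ⟨z, hz, rfl⟩, h⟩ := convexHull_exists_dist_ge2
    (linearCombination_mem_convexHull p ha ha1 subset_rfl)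
    (linearCombination_mem_convexHull p hb hb1 subset_rfl)
  exact h.trans (hD y hy z hz)

/-- By convexity the barycenter of `s` may be replaced by some vertex $y\in s$. Then $p(y)-b(t)$ is
the average over $z\in t$ of $p(y)-p(z)$, whose term $z=y$ vanishes; this gives the factor
$1-1/|t|$. -/
theorem dist_barycenter_le {P E : Type*} [SeminormedAddCommGroup E] [NormedSpace ℝ E]
    (p : P → E) {s t : Finset P} (hs : s.Nonempty) (hst : s ⊆ t) {D : ℝ} (hD0 : 0 ≤ D)
    (hD : ∀ y ∈ t, ∀ z ∈ t, dist (p y) (p z) ≤ D) {d : ℕ} (hd : t.card ≤ d) :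
    dist (Finsupp.linearCombination ℝ p (barycenter s))
      (Finsupp.linearCombination ℝ p (barycenter t)) ≤ (1 - 1 / d) * D := by
  classical
  have ht := hs.mono hst
  have hc : (0 : ℝ) < t.card := by exact_mod_cast ht.card_pos
  obtain ⟨_, ⟨y, hy, rfl⟩, _, rfl, h⟩ := convexHull_exists_dist_ge2
    (linearCombination_mem_convexHull p (barycenter_nonneg s) (barycenter_sum hs)
      (barycenter_support s))
    (subset_convexHull ℝ {Finsupp.linearCombination ℝ p (barycenter t)} rfl)
  refine h.trans ?_
  have hy' : y ∈ t := hst hy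
  have h1 : Finsupp.linearCombination ℝ p (barycenter t) =
      (1 / (t.card : ℝ)) • ∑ z ∈ t, p z := by
    rw [barycenter, map_sum, Finset.smul_sum]
    exact Finset.sum_congr rfl fun z _ => Finsupp.linearCombination_single ..
  have h2 : p y - Finsupp.linearCombination ℝ p (barycenter t) =
      (1 / (t.card : ℝ)) • ∑ z ∈ t.erase y, (p y - p z) := by
    have h3 : ∑ z ∈ t.erase y, (p y - p z) = ∑ z ∈ t, (p y - p z) := by
      rw [← Finset.add_sum_erase t _ hy', sub_self, zero_add]
    rw [h3, Finset.sum_sub_distrib, smul_sub, h1, Finset.sum_const, ← Nat.cast_smul_eq_nsmul ℝ,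
      smul_smul, one_div_mul_cancel hc.ne', one_smul]
  rw [dist_eq_norm, h2, norm_smul, Real.norm_of_nonneg (by positivity)]
  calc 1 / (t.card : ℝ) * ‖∑ z ∈ t.erase y, (p y - p z)‖
      ≤ 1 / (t.card : ℝ) * ∑ z ∈ t.erase y, D := by
        gcongr
        refine norm_sum_le_of_le _ fun z hz => ?_
        rw [← dist_eq_norm]
        exact hD y hy' z (Finset.mem_of_mem_erase hz)
    _ = (1 - 1 / t.card) * D := by
        rw [Finset.sum_const, nsmul_eq_mul, Finset.card_erase_of_mem hy',
          Nat.cast_sub ht.card_pos, Nat.cast_one]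
        field_simp
    _ ≤ (1 - 1 / d) * D := by
        gcongr

/-- Cardinality is injective on a chain and takes values in $\{1,\dots,d\}$. Thus one contraction
factor serves for all subdivisions. -/
theorem card_le_of_mem_barycentric {K : PreAbstractSimplicialComplex V} {d : ℕ}
    (hd : ∀ s ∈ K.faces, s.card ≤ d) : ∀ Γ ∈ (barycentric K).faces, Γ.card ≤ d := by
  intro Γ hΓ
  have h := Finset.card_le_card_of_injOn (s := Γ) (t := Finset.Icc 1 d) Finset.card
    (fun s hs => by
      have hs' := hΓ.2.1 s hs
      exact Finset.mem_coe.2 (Finset.mem_Icc.2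
        ⟨(K.isRelLowerSet_faces hs').1.card_pos, hd s hs'⟩))
    (fun s hs t ht hst => by
      rcases hΓ.2.2 s hs t ht with h | h
      · exact Finset.eq_of_subset_of_card_le h hst.ge
      · exact (Finset.eq_of_subset_of_card_le h hst.le).symm)
  simpa using h

theorem card_le_of_mem_subdiv {K : PreAbstractSimplicialComplex V} {d : ℕ}
    (hd : ∀ s ∈ K.faces, s.card ≤ d) : ∀ m, ∀ s ∈ (subdiv K m).faces, s.card ≤ d
  | 0 => hd
  | m + 1 => card_le_of_mem_barycentric (card_le_of_mem_subdiv hd m)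

theorem norm_finsuppToLp_single (v : V) : ‖finsuppToLp V (Finsupp.single v 1)‖ = 1 := by
  classical
  have h : finsuppToLp V (Finsupp.single v 1) = lp.single 2 v (1 : ℝ) := by
    ext w
    change Finsupp.single v (1 : ℝ) w = _
    rw [lp.single_apply, Finsupp.single_apply, Pi.single_apply]
    simp only [eq_comm]
  rw [h, lp.norm_single (by norm_num), norm_one]

theorem dist_subdivPoint_le {K : PreAbstractSimplicialComplex V} {d : ℕ} (hd0 : 0 < d)
    (hd : ∀ s ∈ K.faces, s.card ≤ d) : ∀ m, ∀ s ∈ (subdiv K m).faces, ∀ v ∈ s, ∀ w ∈ s,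
      dist (finsuppToLp V (subdivPoint V m v)) (finsuppToLp V (subdivPoint V m w)) ≤
        (1 - 1 / (d : ℝ)) ^ m * 2 := by
  have hd1 : 0 ≤ 1 - 1 / (d : ℝ) := by
    rw [sub_nonneg]
    exact div_le_one_of_le₀ (by exact_mod_cast hd0) (Nat.cast_nonneg d)
  intro m
  induction m with
  | zero =>
    intro s _ v _ w _
    refine (dist_le_norm_add_norm _ _).trans ?_
    have h : ∀ v : V, ‖finsuppToLp V (subdivPoint V 0 v)‖ = 1 := norm_finsuppToLp_single
    rw [h v, h w]
    norm_num
  | succ m ih =>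
    have key : ∀ s t : Finset (SubdivVertex V m), s.Nonempty → s ⊆ t → t ∈ (subdiv K m).faces →
        dist (finsuppToLp V (subdivPoint V (m + 1) s)) (finsuppToLp V (subdivPoint V (m + 1) t)) ≤
          (1 - 1 / (d : ℝ)) ^ (m + 1) * 2 := by
      intro s t hs hst ht
      have h := dist_barycenter_le (fun v => finsuppToLp V (subdivPoint V m v)) hs hst
        (by positivity) (ih t ht) (card_le_of_mem_subdiv hd m t ht)
      rw [pow_succ', mul_assoc]
      convert h using 2
      · exact Finsupp.apply_linearCombination ℝ (finsuppToLp V) (subdivPoint V m) (barycenter s)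
      · exact Finsupp.apply_linearCombination ℝ (finsuppToLp V) (subdivPoint V m) (barycenter t)
    intro Γ hΓ s hs t ht
    have hs' := hΓ.2.1 s hs
    have ht' := hΓ.2.1 t ht
    rcases hΓ.2.2 s hs t ht with h | h
    · exact key s t ((subdiv K m).isRelLowerSet_faces hs').1 h ht'
    · rw [dist_comm]
      exact key t s ((subdiv K m).isRelLowerSet_faces ht').1 h hs'

theorem exists_subdiv_mesh_lt {K : PreAbstractSimplicialComplex V} (hK : K.faces.Finite) {δ : ℝ}
    (hδ : 0 < δ) : ∃ m, 0 < m ∧ ∀ s ∈ (subdiv K m).faces, ∀ α β : Realization (subdiv K m),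
      α.coord.support ⊆ s → β.coord.support ⊆ s →
        dist (subdivMap K m α) (subdivMap K m β) < δ := by
  obtain ⟨d, hd0, hd⟩ := exists_card_le hK
  have hd' : (0 : ℝ) < d := by exact_mod_cast hd0
  have hd1 : 0 ≤ 1 - 1 / (d : ℝ) := by
    rw [sub_nonneg]
    exact div_le_one_of_le₀ (by exact_mod_cast hd0) (Nat.cast_nonneg d)
  have hd2 : 1 - 1 / (d : ℝ) < 1 := sub_lt_self _ (by positivity)
  obtain ⟨m, hm⟩ := exists_pow_lt_of_lt_one (half_pos hδ) hd2
  -- Simplicial operations require positive subdivision levels, hence `m + 1`.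
  refine ⟨m + 1, m.succ_pos, fun s hs α β hα hβ => ?_⟩
  rw [Realization.dist_eq_dist_finsuppToLp, subdivMap_coord, subdivMap_coord,
    Finsupp.apply_linearCombination, Finsupp.apply_linearCombination]
  refine (dist_linearCombination_le _ α.coord_nonneg α.coord_sum β.coord_nonneg β.coord_sum
    fun v hv w hw => dist_subdivPoint_le hd0 hd (m + 1) s hs v (hα hv) w (hβ hw)).trans_lt ?_
  have : (1 - 1 / (d : ℝ)) ^ (m + 1) ≤ (1 - 1 / (d : ℝ)) ^ m :=
    pow_le_pow_of_le_one hd1 hd2.le m.le_succ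
  linarith

end Subdivision

/-! ### Simplicial approximation -/

section Approximation

variable {V : Type u} {W : Type v}

/-- The vertex `v`, as a point of the realization. -/
def vertexPoint {K : PreAbstractSimplicialComplex V} {v : V} (hv : {v} ∈ K.faces) :
    Realization K :=
  Realization.mk' (Finsupp.single v 1) (Finsupp.single_nonneg.2 zero_le_one)
    ⟨_, hv, Finsupp.support_single_subset⟩ (Finsupp.sum_single_index rfl)

theorem exists_support_eq {K : PreAbstractSimplicialComplex V} {s : Finset V} (hs : s ∈ K.faces) :
    ∃ α : Realization K, α.coord.support = s := by
  classical
  have hne := (K.isRelLowerSet_faces hs).1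
  refine ⟨Realization.mk' (barycenter s) (barycenter_nonneg s) ⟨s, hs, barycenter_support s⟩
    (barycenter_sum hne), (barycenter_support s).antisymm fun v hv => ?_⟩
  have hc : (s.card : ℝ) ≠ 0 := by exact_mod_cast hne.card_pos.ne'
  rw [Finsupp.mem_support_iff, barycenter_apply, if_pos hv]
  exact one_div_ne_zero hc

theorem exists_simplicial_approximation {X : PreAbstractSimplicialComplex W}
    {K : PreAbstractSimplicialComplex V} (hX : X.faces.Finite) (hK : K.faces.Finite)
    {F : Realization X → Realization K} (hF : Continuous F) {ε : ℝ} (hε : 0 < ε) :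
    ∃ M N : ℕ, 0 < M ∧ 0 < N ∧ ∃ (φ : SubdivVertex W M → SubdivVertex V N)
      (hφ : IsSimplicial (subdiv X M) (subdiv K N) φ), ∀ α : Realization (subdiv X M),
        dist (F (subdivMap X M α)) (subdivMap K N (Realization.map φ hφ α)) < ε := by
  classical
  obtain ⟨N, hN, hmeshN⟩ := exists_subdiv_mesh_lt hK hε
  -- Supplies the irrelevant values of `φ` off the vertices; `N > 0` makes the type inhabited even
  -- if `V` is empty.
  have : Nonempty (SubdivVertex V N) := by
    obtain ⟨N, rfl⟩ := Nat.exists_eq_succ_of_ne_zero hN.ne'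
    exact ⟨(∅ : Finset (SubdivVertex V N))⟩
  set h : Realization X → Realization (subdiv K N) := fun x => (subdivHomeomorph hK N).symm (F x)
    with hh
  have hcont : Continuous h := (subdivHomeomorph hK N).symm.continuous.comp hF
  have := compactSpace_realization hX
  -- The cover consists of the preimages under `h` of the open stars of the vertices of $K^{(N)}$.
  obtain ⟨δ, hδ, hball⟩ := lebesgue_number_lemma_of_metric
    (c := fun w => {x | (h x).coord w ≠ 0}) (isCompact_univ (X := Realization X))
    (fun w => isOpen_ne_fun ((Realization.continuous_coord w).comp hcont) continuous_const)
    (fun x _ => by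
      obtain ⟨w, hw⟩ := ((subdiv K N).isRelLowerSet_faces (h x).carrier_mem).1
      exact Set.mem_iUnion.2 ⟨w, Finsupp.mem_support_iff.1 hw⟩)
  obtain ⟨M, hM, hmeshM⟩ := exists_subdiv_mesh_lt hX hδ
  have hex : ∀ v : SubdivVertex W M, ∃ w, ∀ hv : {v} ∈ (subdiv X M).faces,
      Metric.ball (subdivMap X M (vertexPoint hv)) δ ⊆ {x | (h x).coord w ≠ 0} := by
    intro v
    by_cases hv : {v} ∈ (subdiv X M).faces
    · obtain ⟨w, hw⟩ := hball (subdivMap X M (vertexPoint hv)) (Set.mem_univ _)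
      exact ⟨w, fun _ => hw⟩
    · exact ⟨Classical.arbitrary _, fun h => absurd h hv⟩
  choose φ hφ using hex
  -- A point is within `δ` of each vertex `v` of its carrier, so its image under `h` lies in the
  -- open star of `φ v`. Hence `φ` is simplicial, and $|\varphi|(\alpha)$ lies in the carrier
  -- simplex of the value of `h`.
  have hcarrier : ∀ α : Realization (subdiv X M),
      α.coord.support.image φ ⊆ (h (subdivMap X M α)).coord.support := by
    intro α w hw
    obtain ⟨v, hv, rfl⟩ := Finset.mem_image.1 hw
    have hv' : {v} ∈ (subdiv X M).faces := ((subdiv X M).isRelLowerSet_faces α.carrier_mem).2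
      (Finset.singleton_subset_iff.2 hv) (Finset.singleton_nonempty v)
    refine Finsupp.mem_support_iff.2 (hφ v hv' ?_)
    refine hmeshM _ α.carrier_mem α (vertexPoint hv') subset_rfl ?_
    exact Finsupp.support_single_subset.trans (Finset.singleton_subset_iff.2 hv)
  have hsimp : IsSimplicial (subdiv X M) (subdiv K N) φ := by
    intro s hs
    obtain ⟨α, rfl⟩ := exists_support_eq hs
    refine ((subdiv K N).isRelLowerSet_faces (h (subdivMap X M α)).carrier_mem).2 ?_ ?_
    · convert hcarrier α
    · exact ((subdiv X M).isRelLowerSet_faces hs).1.image φ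
  refine ⟨M, N, hM, hN, φ, hsimp, fun α => ?_⟩
  have hF' : F (subdivMap X M α) = subdivMap K N (h (subdivMap X M α)) :=
    ((subdivHomeomorph hK N).apply_symm_apply _).symm
  rw [hF']
  refine hmeshN _ (h (subdivMap X M α)).carrier_mem _ _ subset_rfl ?_
  refine Finset.Subset.trans ?_ (hcarrier α)
  exact Finsupp.mapDomain_support.trans (by rfl)

variable [LinearOrder V] {K : PreAbstractSimplicialComplex V} {n : ℕ}

/-- `G` is known only after composition with a continuous surjection from a compact space to a
Hausdorff one, which is a quotient map. -/
theorem IsSimplicialOperation.continuous (hK : K.faces.Finite)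
    {G : (Fin n → Realization K) → Realization K} (hG : IsSimplicialOperation K G) :
    Continuous G := by
  obtain ⟨M, N, -, -, φ, hφ, h⟩ := hG
  have hP := finite_faces_power hK n
  have := compactSpace_realization (finite_faces_subdiv hP M)
  have hq : IsQuotientMap fun α => powerMap K n (subdivMap (power K n) M α) :=
    IsQuotientMap.of_surjective_continuous
      (powerMap_surjective.comp (subdivMap_bijective _ M).surjective)
      ((continuous_powerMap hK).comp (continuous_subdivMap hP M))
  refine hq.continuous_iff.2 ((continuous_congr h).2 ?_)
  exact (continuous_subdivMap hK N).comp
    (continuous_realization_map (finite_faces_subdiv hP M) (finite_faces_subdiv hK N) φ hφ)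

theorem exists_isSimplicialOperation_near (hK : K.faces.Finite)
    {G : (Fin n → Realization K) → Realization K} (hG : Continuous G) {ε : ℝ} (hε : 0 < ε) :
    ∃ G' : (Fin n → Realization K) → Realization K, IsSimplicialOperation K G' ∧
      ∀ x, dist (G x) (G' x) < ε := by
  have hP := finite_faces_power hK n
  obtain ⟨M, N, hM, hN, φ, hφ, h⟩ := exists_simplicial_approximation hP hK
    (hG.comp (continuous_powerMap hK)) hε
  let e := Equiv.ofBijective (fun α => powerMap K n (subdivMap (power K n) M α))
    (Function.Bijective.comp ⟨powerMap_injective, powerMap_surjective⟩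
      (subdivMap_bijective _ M))
  refine ⟨fun x => subdivMap K N (Realization.map φ hφ (e.symm x)),
    ⟨M, N, hM, hN, φ, hφ, fun α => ?_⟩, fun x => ?_⟩
  · exact congrArg _ (congrArg _ (e.symm_apply_apply α))
  · obtain ⟨α, rfl⟩ := e.surjective x
    beta_reduce
    rw [e.symm_apply_apply]
    exact h α

end Approximation

/-! ### Perturbation of the operations -/

section Perturbation

variable {L : FirstOrder.Language.{v, w}} {A : Type u} [MetricSpace A] [CompactSpace A]

/-- Two structures on a metric space whose operations differ by less than `δ`. -/
def OperationsNear (S S' : L.Structure A) (δ : ℝ) : Prop :=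
  ∀ (n : ℕ) (f : L.Functions n) (x : Fin n → A), dist (S.funMap f x) (S'.funMap f x) < δ

/-- Only the operations of `S` need be continuous, and `δ` works for all `S'` at once. -/
theorem exists_realize_near (S : L.Structure A)
    (hS : ∀ (n : ℕ) (f : L.Functions n), Continuous fun x : Fin n → A => S.funMap f x)
    (σ : L.Term ℕ) : ∀ ε : ℝ, 0 < ε → ∃ δ : ℝ, 0 < δ ∧ ∀ S' : L.Structure A,
      OperationsNear S S' δ → ∀ a : ℕ → A,
        dist (@FirstOrder.Language.Term.realize L A S ℕ a σ)
          (@FirstOrder.Language.Term.realize L A S' ℕ a σ) < ε := by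
  induction σ with
  | var i => exact fun ε hε => ⟨1, one_pos, fun S' _ a => by simpa using hε⟩
  | @func n f t ih =>
    intro ε hε
    obtain ⟨η, hη, hf⟩ := Metric.uniformContinuous_iff.1
      (CompactSpace.uniformContinuous_of_continuous (hS n f)) (ε / 2) (half_pos hε)
    choose δ hδ h using fun i => ih i η hη
    obtain ⟨δ', hδ', hle⟩ : ∃ δ' : ℝ, 0 < δ' ∧ ∀ i, δ' ≤ δ i := by
      rcases isEmpty_or_nonempty (Fin n) with _ | _
      · exact ⟨1, one_pos, fun i => isEmptyElim i⟩
      · obtain ⟨j, -, hj⟩ := Finset.exists_min_image Finset.univ δ Finset.univ_nonempty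
        exact ⟨δ j, hδ j, fun i => hj i (Finset.mem_univ i)⟩
    refine ⟨min δ' (ε / 2), lt_min hδ' (half_pos hε), fun S' hS' a => ?_⟩
    -- `h1` changes the arguments under the operation of `S`; `h2` changes the operation at the
    -- arguments computed in `S'`.
    have h1 := hf ((dist_pi_lt_iff hη).2 fun i => h i S'
      (fun n f x => (hS' n f x).trans_le ((min_le_left _ _).trans (hle i))) a)
    have h2 := (hS' n f fun i => @FirstOrder.Language.Term.realize L A S' ℕ a (t i)).trans_le
      (min_le_right _ _)
    refine (dist_triangle _ _ _).trans_lt ((add_lt_add h1 h2).trans_eq (add_halves ε))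

theorem exists_lambdaPair_le (S : L.Structure A)
    (hS : ∀ (n : ℕ) (f : L.Functions n), Continuous fun x : Fin n → A => S.funMap f x)
    (σ τ : L.Term ℕ) {ε : ℝ} (hε : 0 < ε) : ∃ δ : ℝ, 0 < δ ∧ ∀ S' : L.Structure A,
      OperationsNear S S' δ → lambdaPair S' σ τ ≤ lambdaPair S σ τ + ENNReal.ofReal ε := by
  obtain ⟨δ₁, hδ₁, h₁⟩ := exists_realize_near S hS σ (ε / 2) (half_pos hε)
  obtain ⟨δ₂, hδ₂, h₂⟩ := exists_realize_near S hS τ (ε / 2) (half_pos hε)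
  refine ⟨min δ₁ δ₂, lt_min hδ₁ hδ₂, fun S' hS' => iSup_le fun a => ?_⟩
  have h₁ := h₁ S' (fun n f x => (hS' n f x).trans_le (min_le_left _ _)) a
  have h₂ := h₂ S' (fun n f x => (hS' n f x).trans_le (min_le_right _ _)) a
  rw [dist_comm] at h₁
  have h₁' := (edist_dist _ _).trans_le (ENNReal.ofReal_le_ofReal h₁.le)
  have h₂' := (edist_dist _ _).trans_le (ENNReal.ofReal_le_ofReal h₂.le)
  have h₃ : edist (@FirstOrder.Language.Term.realize L A S ℕ a σ)
      (@FirstOrder.Language.Term.realize L A S ℕ a τ) ≤ lambdaPair S σ τ :=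
    le_iSup (fun a => edist (@FirstOrder.Language.Term.realize L A S ℕ a σ)
      (@FirstOrder.Language.Term.realize L A S ℕ a τ)) a
  refine (edist_triangle4 _ _ _ _).trans ((add_le_add (add_le_add h₁' h₃) h₂').trans_eq ?_)
  rw [add_right_comm, ← ENNReal.ofReal_add (half_pos hε).le (half_pos hε).le, add_halves, add_comm]

theorem exists_lambdaAlg_le (S : L.Structure A)
    (hS : ∀ (n : ℕ) (f : L.Functions n), Continuous fun x : Fin n → A => S.funMap f x)
    {E : Set (L.Term ℕ × L.Term ℕ)} (hE : E.Finite) {ε : ℝ} (hε : 0 < ε) :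
    ∃ δ : ℝ, 0 < δ ∧ ∀ S' : L.Structure A,
      OperationsNear S S' δ → lambdaAlg S' E ≤ lambdaAlg S E + ENNReal.ofReal ε := by
  choose δ hδ h using fun e : L.Term ℕ × L.Term ℕ => exists_lambdaPair_le S hS e.1 e.2 hε
  -- Finiteness of `E` enters here, to give one tolerance for all equations.
  obtain ⟨δ', hδ', hle⟩ : ∃ δ' : ℝ, 0 < δ' ∧ ∀ e ∈ E, δ' ≤ δ e := by
    rcases E.eq_empty_or_nonempty with rfl | hne
    · exact ⟨1, one_pos, by simp⟩
    · obtain ⟨e, -, he⟩ := Set.exists_min_image E δ hE hne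
      exact ⟨δ e, hδ e, he⟩
  refine ⟨δ', hδ', fun S' hS' => iSup₂_le fun e he => ?_⟩
  refine (h e S' fun n f x => (hS' n f x).trans_le (hle e he)).trans ?_
  gcongr
  exact le_iSup₂ (f := fun e (_ : e ∈ E) => lambdaPair S e.1 e.2) e he

end Perturbation

/-! ### The two inequalities. -/

section Comparison

variable {V : Type u} [LinearOrder V] {K : PreAbstractSimplicialComplex V}
  {L : FirstOrder.Language.{v, w}}

theorem lambda_le_lambdaSimp (hK : K.faces.Finite) (E : Set (L.Term ℕ × L.Term ℕ)) :
    lambda (Realization K) E ≤ lambdaSimp K E :=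
  le_iInf₂ fun S hS => iInf₂_le S fun n f => (hS n f).continuous hK

theorem lambdaSimp_le_lambda [L.IsAlgebraic] (hK : K.faces.Finite)
    {E : Set (L.Term ℕ × L.Term ℕ)} (hE : E.Finite) :
    lambdaSimp K E ≤ lambda (Realization K) E := by
  have := compactSpace_realization hK
  refine le_iInf₂ fun S hS => ENNReal.le_of_forall_pos_le_add fun ε hε _ => ?_
  obtain ⟨δ, hδ, hnear⟩ := exists_lambdaAlg_le S hS hE (NNReal.coe_pos.2 hε)
  choose G hG hGS using fun (n : ℕ) (f : L.Functions n) =>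
    exists_isSimplicialOperation_near hK (hS n f) hδ
  rw [ENNReal.ofReal_coe_nnreal] at hnear
  let S' : L.Structure (Realization K) :=
    { funMap := fun {n} f => G n f, RelMap := fun r => isEmptyElim r }
  exact (iInf₂_le S' hG).trans (hnear S' hGS)

end Comparison

end SimplicialOps

end

theorem mainTheorem2 {V : Type u} [LinearOrder V] (K : PreAbstractSimplicialComplex V)
    (hK : K.faces.Finite) {L : FirstOrder.Language.{v, w}} [L.IsAlgebraic]
    (E : Set (L.Term ℕ × L.Term ℕ)) (hE : E.Finite) :
    SimplicialOps.lambdaSimp K E = SimplicialOps.lambda (SimplicialOps.Realization K) E :=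
  le_antisymm (SimplicialOps.lambdaSimp_le_lambda hK hE) (SimplicialOps.lambda_le_lambdaSimp hK E)
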